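/- Let $\Omega=[a,b]$ with $0<a<b$, let $n\ge 1$ be an integer and $\alpha\in(n-1,n)$. Write $D_H=x\frac{d}{dx}$. For $u\in L^2(\Omega)$ the left and right Hadamard derivatives of order $\alpha$ are $$D^\alpha_{[a,x]}u=\frac{1}{\Gamma(n-\alpha)}D_H^n\int_a^x\Big(\ln\frac xt\Big)^{n-\alpha-1}\frac{u(t)}{t}\,dt,\qquad D^\alpha_{[x,b]}u=\frac{1}{\Gamma(n-\alpha)}(-D_H)^n\int_x^b\Big(\ln\frac tx\Big)^{n-\alpha-1}\frac{u(t)}{t}\,dt,$$ and the Riesz–Hadamard derivative is $D^\alpha u=\frac12\big(D^\alpha_{[a,x]}u+(-1)^nD^\alpha_{[x,b]}u\big)$; the derivatives are taken in the weak sense, i.e. by integration by parts with respect to $dx/x$ against functions $g\in C^n([a,b])$ with $g^{(i)}(a)=g^{(i)}(b)=0$ for $0\le i\le n$. Let $W^\alpha_2(\Omega)$ be the space of all $u\in L^2(\Omega)$ with $D^\alpha u\in L^2(\Omega)$, with norm $\|u\|^2=\int_a^b|u|^2dx+\int_a^b|D^\alpha u|^2dx$ and its Borel $\sigma$-algebra.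 Let $\Sigma$ be a symmetric positive definite $m\times m$ matrix and $\|z\|_\Sigma=\|\Sigma^{-1/2}z\|_2$ for $z\in\mathbb R^m$. Let $G:W^\alpha_2(\Omega)\to\mathbb R^m$ satisfy: (a) for every $\varepsilon>0$ there is $M\in\mathbb R$ with $\|G(u)\|_\Sigma\le\exp(\varepsilon\|u\|^2+M)$ for all $u\in W^\alpha_2(\Omega)$; (b) for every $r>0$ there is $K>0$ with $\|G(u_1)-G(u_2)\|_\Sigma\le K\|u_1-u_2\|$ whenever $\max\{\|u_1\|,\|u_2\|\}<r$. Let $\lambda\ge 0$, $R(u)=\lambda\int_a^b|D^\alpha u|\,dx$, $\Phi(u;y)=\frac12\|G(u)-y\|_\Sigma^2$, and let $\mu_0$ be a Gaussian measure on $W^\alpha_2(\Omega)$. Then: (i) For every $y\in\mathbb R^m$ the function $u\mapsto\exp(-\Phi(u;y)-R(u))$ is measurable and $\mu_0$-integrable, with integral $Z(y)>0$, and there is exactly one probability measure $\mu^y\ll\mu_0$ on $W^\alpha_2(\Omega)$ with $\frac{d\mu^y}{d\mu_0}(u)\propto\exp(-\Phi(u;y)-R(u))$, namely the one with density $Z(y)^{-1}\exp(-\Phi(u;y)-R(u))$.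 (ii) For every $r>0$ there is $C=C(r)>0$ such that for all $y,y'\in\mathbb R^m$ with $\max\{\|y\|_\Sigma,\|y'\|_\Sigma\}<r$, $$d_{\mathrm{Hell}}(\mu^y,\mu^{y'})\le C\|y-y'\|_\Sigma,\qquad d_{\mathrm{Hell}}(\mu,\mu')=\Big(\frac12\int\Big(\sqrt{\tfrac{d\mu}{d\nu}}-\sqrt{\tfrac{d\mu'}{d\nu}}\Big)^2d\nu\Big)^{1/2},$$ where $\nu$ is any $\sigma$-finite measure dominating $\mu$ and $\mu'$ (the value does not depend on $\nu$). (iii) For every real Banach space $E$ (in particular for the Cameron–Martin space of $\mu_0$) and every strongly $\mu_0$-measurable $f:W^\alpha_2(\Omega)\to E$ that is polynomially bounded, i.e. $\|f(u)\|_E\le C(1+\|u\|^k)$ for some $C\in\mathbb R$, $k\in\mathbb N$, the function $f$ is $\mu^y$-integrable for every $y$, and $y\mapsto\int f\,d\mu^y$ is continuous on $\mathbb R^m$. -/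

import Mathlib

open MeasureTheory ProbabilityTheory Set
open scoped ENNReal ContDiff MatrixOrder

noncomputable section

/-- An interval `[a, b]` with `0 < a < b` and an order `α ∈ (n - 1, n)`, `n` a positive integer. -/
structure HadamardParams where
  a : ℝ
  b : ℝ
  α : ℝ
  n : ℕ
  a_pos : 0 < a
  a_lt_b : a < b
  one_le_n : 1 ≤ n
  lt_α : (n : ℝ) - 1 < α
  α_lt : α < n

namespace HadamardParams

variable (P : HadamardParams)

/-- Lebesgue measure on `Ω = [a, b]`. -/
abbrev vol : Measure ℝ := volume.restrict (Icc P.a P.b)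

/-- The space `L²(Ω)`. -/
abbrev L2 : Type := Lp ℝ 2 P.vol

/-- The left Hadamard integral of order `n - α`:
`(1 / Γ(n - α)) ∫_a^x (ln (x / t)) ^ (n - α - 1) u(t) dt / t`. -/
def leftIntegral (u : ℝ → ℝ) (x : ℝ) : ℝ :=
  (Real.Gamma (P.n - P.α))⁻¹ *
    ∫ t in P.a..x, Real.log (x / t) ^ ((P.n : ℝ) - P.α - 1) * (u t / t)

/-- The right Hadamard integral of order `n - α`:
`(1 / Γ(n - α)) ∫_x^b (ln (t / x)) ^ (n - α - 1) u(t) dt / t`. -/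
def rightIntegral (u : ℝ → ℝ) (x : ℝ) : ℝ :=
  (Real.Gamma (P.n - P.α))⁻¹ *
    ∫ t in x..P.b, Real.log (t / x) ^ ((P.n : ℝ) - P.α - 1) * (u t / t)

end HadamardParams

/-- The differential operator `D_H = x d/dx`. -/
def hadamardOp (f : ℝ → ℝ) : ℝ → ℝ := fun x => x * deriv f x

namespace HadamardParams

variable (P : HadamardParams)

/-- Test functions: `C^n` functions on `[a, b]` all of whose derivatives of order `0, …, n` vanish
at `a` and `b`, represented by their extensions by zero, which are the `C^n` functions
on the line supported in `[a, b]`. -/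
structure IsTest (g : ℝ → ℝ) : Prop where
  contDiff : ContDiff ℝ P.n g
  support_subset : Function.support g ⊆ Icc P.a P.b

/-- The left Hadamard derivative `(x d/dx)^n (leftIntegral u)`, in the weak sense, tested
against `g` with respect to `dx / x`; the operator `x d/dx` is antisymmetric for `dx / x`. -/
def leftPairing (u g : ℝ → ℝ) : ℝ :=
  (-1) ^ P.n * ∫ x in P.a..P.b, x⁻¹ * (P.leftIntegral u x * hadamardOp^[P.n] g x)

/-- The right Hadamard derivative `(-x d/dx)^n (rightIntegral u)`, in the weak sense, tested
against `g` with respect to `dx / x`. -/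
def rightPairing (u g : ℝ → ℝ) : ℝ :=
  ∫ x in P.a..P.b, x⁻¹ * (P.rightIntegral u x * hadamardOp^[P.n] g x)

/-- `v` is the (weak) Riesz–Hadamard derivative of order `α` of `u`: it is
`(1/2) (left derivative + (-1)^n right derivative)`. -/
def IsRieszHadamardDeriv (u v : P.L2) : Prop :=
  ∀ g : ℝ → ℝ, P.IsTest g →
    ∫ x in P.a..P.b, x⁻¹ * (v x * g x) =
      1 / 2 * (P.leftPairing u g + (-1) ^ P.n * P.rightPairing u g)

end HadamardParams

/-! Integrability of the Hadamard integrals, needed for linearity of the weak derivative. -/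

theorem integrable_kernel_mul {k : ℝ × ℝ → ℝ} {κ U : ℝ → ℝ} (hk : Measurable k)
    (hκ : Integrable κ) (hU : Integrable U) (hb : ∀ p, |k p| ≤ κ (p.1 - p.2)) :
    Integrable (fun p : ℝ × ℝ => k p * U p.2) (volume.prod volume) := by
  have h := Integrable.convolution_integrand (ContinuousLinearMap.mul ℝ ℝ) hU hκ
  refine h.mono (hk.aestronglyMeasurable.mul hU.aestronglyMeasurable.comp_snd) ?_
  refine Filter.Eventually.of_forall fun p => ?_
  simp only [ContinuousLinearMap.mul_apply', norm_mul, Real.norm_eq_abs]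
  rw [mul_comm]
  exact mul_le_mul_of_nonneg_left ((hb p).trans (le_abs_self _)) (abs_nonneg _)

theorem log_rpow_le {a b e t x : ℝ} (ha : 0 < a) (he : e < 0) (hat : a ≤ t) (htx : t ≤ x)
    (hxb : x ≤ b) : |Real.log (x / t) ^ e / t| ≤ a⁻¹ * ((x - t) / b) ^ e := by
  have ht : 0 < t := ha.trans_le hat
  have hx : 0 < x := ht.trans_le htx
  have hb : 0 < b := hx.trans_le hxb
  rcases htx.eq_or_lt with rfl | hlt
  · simp [div_self ht.ne', Real.zero_rpow he.ne]
  have h1 : (x - t) / b ≤ Real.log (x / t) := by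
    have h := Real.log_le_sub_one_of_pos (div_pos ht hx)
    have h2 : Real.log (x / t) = -Real.log (t / x) := by rw [← Real.log_inv, inv_div]
    have h3 : (x - t) / b ≤ (x - t) / x :=
      div_le_div_of_nonneg_left (by linarith) hx hxb
    have h4 : (x - t) / x = 1 - t / x := by field_simp
    linarith
  have h0 : 0 < (x - t) / b := div_pos (by linarith) hb
  have h5 := Real.rpow_le_rpow_of_nonpos h0 h1 he.le
  have h6 : 0 ≤ Real.log (x / t) ^ e := Real.rpow_nonneg (h0.le.trans h1) _
  rw [abs_of_nonneg (div_nonneg h6 ht.le), div_eq_inv_mul]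
  exact mul_le_mul (inv_anti₀ ha hat) h5 h6 (inv_pos.2 ha).le

namespace HadamardParams

variable (P : HadamardParams)

theorem exponent_neg : (P.n : ℝ) - P.α - 1 < 0 := by have := P.lt_α; linarith

theorem neg_one_lt_exponent : -1 < (P.n : ℝ) - P.α - 1 := by have := P.α_lt; linarith

theorem b_pos : 0 < P.b := P.a_pos.trans P.a_lt_b

/-- Dominating convolution kernel. -/
def domKernel (z : ℝ) : ℝ :=
  (Icc 0 (P.b - P.a)).indicator
    (fun z => P.a⁻¹ * (z / P.b) ^ ((P.n : ℝ) - P.α - 1)) z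

theorem integrable_domKernel : Integrable P.domKernel := by
  unfold domKernel
  rw [integrable_indicator_iff measurableSet_Icc]
  have h : IntervalIntegrable (fun z : ℝ => z ^ ((P.n : ℝ) - P.α - 1)) volume 0 (P.b - P.a) :=
    intervalIntegral.intervalIntegrable_rpow' P.neg_one_lt_exponent
  rw [intervalIntegrable_iff_integrableOn_Icc_of_le (by linarith [P.a_lt_b])] at h
  refine IntegrableOn.congr_fun
    (h.const_mul (P.a⁻¹ * (P.b ^ ((P.n : ℝ) - P.α - 1))⁻¹)) ?_ measurableSet_Icc
  intro z hz
  simp only [Real.div_rpow hz.1 P.b_pos.le]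
  ring

/-- Kernel of the left Hadamard integral. -/
def leftKernel (p : ℝ × ℝ) : ℝ :=
  {p : ℝ × ℝ | P.a < p.2 ∧ p.2 ≤ p.1 ∧ p.1 ≤ P.b}.indicator
    (fun p => Real.log (p.1 / p.2) ^ ((P.n : ℝ) - P.α - 1) / p.2) p

/-- Kernel of the right Hadamard integral. -/
def rightKernel (p : ℝ × ℝ) : ℝ :=
  {p : ℝ × ℝ | P.a ≤ p.1 ∧ p.1 < p.2 ∧ p.2 ≤ P.b}.indicator
    (fun p => Real.log (p.2 / p.1) ^ ((P.n : ℝ) - P.α - 1) / p.2) p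

theorem measurable_leftKernel : Measurable P.leftKernel := by
  refine Measurable.indicator (by fun_prop) ?_
  exact (measurableSet_lt measurable_const measurable_snd).inter
    ((measurableSet_le measurable_snd measurable_fst).inter
      (measurableSet_le measurable_fst measurable_const))

theorem measurable_rightKernel : Measurable P.rightKernel := by
  refine Measurable.indicator (by fun_prop) ?_
  exact (measurableSet_le measurable_const measurable_fst).inter
    ((measurableSet_lt measurable_fst measurable_snd).inter
      (measurableSet_le measurable_snd measurable_const))

theorem domKernel_nonneg (z : ℝ) : 0 ≤ P.domKernel z := by
  refine indicator_nonneg (fun z hz => ?_) z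
  exact mul_nonneg (inv_pos.2 P.a_pos).le (Real.rpow_nonneg (div_nonneg hz.1 P.b_pos.le) _)

theorem abs_leftKernel_le (p : ℝ × ℝ) : |P.leftKernel p| ≤ P.domKernel (p.1 - p.2) := by
  by_cases hp : P.a < p.2 ∧ p.2 ≤ p.1 ∧ p.1 ≤ P.b
  · have h1 : P.leftKernel p = Real.log (p.1 / p.2) ^ ((P.n : ℝ) - P.α - 1) / p.2 :=
      indicator_of_mem (s := {p : ℝ × ℝ | P.a < p.2 ∧ p.2 ≤ p.1 ∧ p.1 ≤ P.b}) hp _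
    have h2 : p.1 - p.2 ∈ Icc 0 (P.b - P.a) := ⟨by linarith [hp.2.1], by linarith [hp.1, hp.2.2]⟩
    rw [h1, domKernel, indicator_of_mem h2]
    exact log_rpow_le P.a_pos P.exponent_neg hp.1.le hp.2.1 hp.2.2
  · have h1 : P.leftKernel p = 0 :=
      indicator_of_notMem (s := {p : ℝ × ℝ | P.a < p.2 ∧ p.2 ≤ p.1 ∧ p.1 ≤ P.b}) hp _
    rw [h1, abs_zero]
    exact P.domKernel_nonneg _

theorem abs_rightKernel_le (p : ℝ × ℝ) : |P.rightKernel p| ≤ P.domKernel (-(p.1 - p.2)) := by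
  by_cases hp : P.a ≤ p.1 ∧ p.1 < p.2 ∧ p.2 ≤ P.b
  · have h1 : P.rightKernel p = Real.log (p.2 / p.1) ^ ((P.n : ℝ) - P.α - 1) / p.2 :=
      indicator_of_mem (s := {p : ℝ × ℝ | P.a ≤ p.1 ∧ p.1 < p.2 ∧ p.2 ≤ P.b}) hp _
    have h2 : -(p.1 - p.2) ∈ Icc 0 (P.b - P.a) :=
      ⟨by linarith [hp.2.1], by linarith [hp.1, hp.2.2]⟩
    rw [h1, domKernel, indicator_of_mem h2, neg_sub]
    refine le_trans ?_ (log_rpow_le P.a_pos P.exponent_neg hp.1 hp.2.1.le hp.2.2)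
    have hx : 0 < p.1 := P.a_pos.trans_le hp.1
    rw [abs_div, abs_div, abs_of_pos hx, abs_of_pos (hx.trans hp.2.1)]
    exact div_le_div_of_nonneg_left (abs_nonneg _) hx hp.2.1.le
  · have h1 : P.rightKernel p = 0 :=
      indicator_of_notMem (s := {p : ℝ × ℝ | P.a ≤ p.1 ∧ p.1 < p.2 ∧ p.2 ≤ P.b}) hp _
    rw [h1, abs_zero]
    exact P.domKernel_nonneg _

theorem integrable_leftKernel_mul {U : ℝ → ℝ} (hU : Integrable U) :
    Integrable (fun p : ℝ × ℝ => P.leftKernel p * U p.2) (volume.prod volume) :=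
  integrable_kernel_mul P.measurable_leftKernel P.integrable_domKernel hU P.abs_leftKernel_le

theorem integrable_rightKernel_mul {U : ℝ → ℝ} (hU : Integrable U) :
    Integrable (fun p : ℝ × ℝ => P.rightKernel p * U p.2) (volume.prod volume) :=
  integrable_kernel_mul (κ := fun z => P.domKernel (-z)) P.measurable_rightKernel
    P.integrable_domKernel.comp_neg hU P.abs_rightKernel_le

theorem leftIntegral_eq (u : ℝ → ℝ) {x : ℝ} (hx : x ∈ Icc P.a P.b) :
    P.leftIntegral u x = (Real.Gamma (P.n - P.α))⁻¹ *
      ∫ t, P.leftKernel (x, t) * (Icc P.a P.b).indicator u t := by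
  rw [leftIntegral, intervalIntegral.integral_of_le hx.1,
    ← integral_indicator measurableSet_Ioc]
  congr 2
  ext t
  by_cases ht : t ∈ Ioc P.a x
  · have h1 : P.leftKernel (x, t) = Real.log (x / t) ^ ((P.n : ℝ) - P.α - 1) / t :=
      indicator_of_mem (s := {p : ℝ × ℝ | P.a < p.2 ∧ p.2 ≤ p.1 ∧ p.1 ≤ P.b})
        (a := (x, t)) ⟨ht.1, ht.2, hx.2⟩ _
    rw [indicator_of_mem ht, h1,
      indicator_of_mem (show t ∈ Icc P.a P.b from ⟨ht.1.le, ht.2.trans hx.2⟩)]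
    ring
  · have h1 : P.leftKernel (x, t) = 0 :=
      indicator_of_notMem (s := {p : ℝ × ℝ | P.a < p.2 ∧ p.2 ≤ p.1 ∧ p.1 ≤ P.b})
        (a := (x, t)) (fun h => ht ⟨h.1, h.2.1⟩) _
    rw [indicator_of_notMem ht, h1, zero_mul]

theorem rightIntegral_eq (u : ℝ → ℝ) {x : ℝ} (hx : x ∈ Icc P.a P.b) :
    P.rightIntegral u x = (Real.Gamma (P.n - P.α))⁻¹ *
      ∫ t, P.rightKernel (x, t) * (Icc P.a P.b).indicator u t := by
  rw [rightIntegral, intervalIntegral.integral_of_le hx.2,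
    ← integral_indicator measurableSet_Ioc]
  congr 2
  ext t
  by_cases ht : t ∈ Ioc x P.b
  · have h1 : P.rightKernel (x, t) = Real.log (t / x) ^ ((P.n : ℝ) - P.α - 1) / t :=
      indicator_of_mem (s := {p : ℝ × ℝ | P.a ≤ p.1 ∧ p.1 < p.2 ∧ p.2 ≤ P.b})
        (a := (x, t)) ⟨hx.1, ht.1, ht.2⟩ _
    rw [indicator_of_mem ht, h1,
      indicator_of_mem (show t ∈ Icc P.a P.b from ⟨hx.1.trans ht.1.le, ht.2⟩)]
    ring
  · have h1 : P.rightKernel (x, t) = 0 :=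
      indicator_of_notMem (s := {p : ℝ × ℝ | P.a ≤ p.1 ∧ p.1 < p.2 ∧ p.2 ≤ P.b})
        (a := (x, t)) (fun h => ht ⟨h.2.1, h.2.2⟩) _
    rw [indicator_of_notMem ht, h1, zero_mul]

theorem integrable_indicator_coe (u : P.L2) : Integrable ((Icc P.a P.b).indicator u) := by
  rw [integrable_indicator_iff measurableSet_Icc]
  exact (Lp.memLp u).integrable (by norm_num)

theorem indicator_ae_eq {f g : ℝ → ℝ} (h : f =ᵐ[P.vol] g) :
    (Icc P.a P.b).indicator f =ᵐ[volume] (Icc P.a P.b).indicator g := by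
  have h' := (ae_restrict_iff' measurableSet_Icc).1 h
  filter_upwards [h'] with t ht
  by_cases hm : t ∈ Icc P.a P.b
  · rw [indicator_of_mem hm, indicator_of_mem hm, ht hm]
  · rw [indicator_of_notMem hm, indicator_of_notMem hm]

theorem integrable_leftIntegral (u : P.L2) : Integrable (P.leftIntegral u) P.vol := by
  have h := (P.integrable_leftKernel_mul (P.integrable_indicator_coe u)).integral_prod_left
  refine Integrable.congr (h.integrableOn.const_mul (Real.Gamma (P.n - P.α))⁻¹) ?_
  filter_upwards [ae_restrict_mem measurableSet_Icc] with x hx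
  exact (P.leftIntegral_eq u hx).symm

theorem integrable_rightIntegral (u : P.L2) : Integrable (P.rightIntegral u) P.vol := by
  have h := (P.integrable_rightKernel_mul (P.integrable_indicator_coe u)).integral_prod_left
  refine Integrable.congr (h.integrableOn.const_mul (Real.Gamma (P.n - P.α))⁻¹) ?_
  filter_upwards [ae_restrict_mem measurableSet_Icc] with x hx
  exact (P.rightIntegral_eq u hx).symm

theorem leftIntegral_comb (c : ℝ) (u v : P.L2) :
    P.leftIntegral (c • u + v : P.L2) =ᵐ[P.vol]
      fun x => c * P.leftIntegral u x + P.leftIntegral v x := by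
  have hu := (P.integrable_leftKernel_mul (P.integrable_indicator_coe u)).prod_right_ae
  have hv := (P.integrable_leftKernel_mul (P.integrable_indicator_coe v)).prod_right_ae
  have hc : ((c • u + v : P.L2) : ℝ → ℝ) =ᵐ[P.vol] fun t => c * u t + v t := by
    filter_upwards [Lp.coeFn_add (c • u) v, Lp.coeFn_smul c u] with t h1 h2
    rw [h1, Pi.add_apply, h2, Pi.smul_apply, smul_eq_mul]
  filter_upwards [ae_restrict_mem measurableSet_Icc, ae_restrict_of_ae hu, ae_restrict_of_ae hv]
    with x hx hxu hxv
  rw [P.leftIntegral_eq _ hx, P.leftIntegral_eq _ hx, P.leftIntegral_eq _ hx, mul_left_comm,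
    ← mul_add, ← integral_const_mul (μ := volume) c, ← integral_add (hxu.const_mul c) hxv]
  congr 1
  refine integral_congr_ae ?_
  filter_upwards [P.indicator_ae_eq hc] with t ht
  rw [ht]
  by_cases hm : t ∈ Icc P.a P.b
  · simp only [indicator_of_mem hm]; ring
  · simp only [indicator_of_notMem hm]; ring

theorem rightIntegral_comb (c : ℝ) (u v : P.L2) :
    P.rightIntegral (c • u + v : P.L2) =ᵐ[P.vol]
      fun x => c * P.rightIntegral u x + P.rightIntegral v x := by
  have hu := (P.integrable_rightKernel_mul (P.integrable_indicator_coe u)).prod_right_ae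
  have hv := (P.integrable_rightKernel_mul (P.integrable_indicator_coe v)).prod_right_ae
  have hc : ((c • u + v : P.L2) : ℝ → ℝ) =ᵐ[P.vol] fun t => c * u t + v t := by
    filter_upwards [Lp.coeFn_add (c • u) v, Lp.coeFn_smul c u] with t h1 h2
    rw [h1, Pi.add_apply, h2, Pi.smul_apply, smul_eq_mul]
  filter_upwards [ae_restrict_mem measurableSet_Icc, ae_restrict_of_ae hu, ae_restrict_of_ae hv]
    with x hx hxu hxv
  rw [P.rightIntegral_eq _ hx, P.rightIntegral_eq _ hx, P.rightIntegral_eq _ hx, mul_left_comm,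
    ← mul_add, ← integral_const_mul (μ := volume) c, ← integral_add (hxu.const_mul c) hxv]
  congr 1
  refine integral_congr_ae ?_
  filter_upwards [P.indicator_ae_eq hc] with t ht
  rw [ht]
  by_cases hm : t ∈ Icc P.a P.b
  · simp only [indicator_of_mem hm]; ring
  · simp only [indicator_of_notMem hm]; ring

theorem weighted_integral_comb {h w w₁ w₂ : ℝ → ℝ} {c : ℝ} (hh : Continuous h)
    (h₁ : Integrable w₁ P.vol) (h₂ : Integrable w₂ P.vol)
    (hw : w =ᵐ[P.vol] fun x => c * w₁ x + w₂ x) :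
    ∫ x in P.a..P.b, x⁻¹ * (w x * h x) =
      c * (∫ x in P.a..P.b, x⁻¹ * (w₁ x * h x)) + ∫ x in P.a..P.b, x⁻¹ * (w₂ x * h x) := by
  have key : ∀ f : ℝ → ℝ, Integrable f P.vol →
      Integrable (fun x => x⁻¹ * (f x * h x)) P.vol := by
    intro f hf
    have hcont : ContinuousOn (fun x : ℝ => x⁻¹ * h x) (Icc P.a P.b) :=
      (continuousOn_inv₀.mono fun x hx => (P.a_pos.trans_le hx.1).ne').mul hh.continuousOn
    have := IntegrableOn.mul_continuousOn (μ := volume)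
      (show IntegrableOn f (Icc P.a P.b) volume from hf) hcont
      isCompact_Icc
    refine Integrable.congr this (Filter.Eventually.of_forall fun x => ?_)
    simp only; ring
  simp only [intervalIntegral.integral_of_le P.a_lt_b.le, ← integral_Icc_eq_integral_Ioc]
  rw [← integral_const_mul, ← integral_add ((key _ h₁).const_mul c) (key _ h₂)]
  refine integral_congr_ae ?_
  filter_upwards [hw] with x hx
  rw [hx]; ring

end HadamardParams

theorem continuous_hadamardOp_iterate (n : ℕ) (g : ℝ → ℝ) (hg : ContDiff ℝ n g) :
    Continuous (hadamardOp^[n] g) := by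
  induction n generalizing g with
  | zero => simpa using hg.continuous
  | succ n ih =>
    rw [Function.iterate_succ_apply]
    refine ih _ ?_
    have : ContDiff ℝ n (deriv g) := by
      have h := (contDiff_succ_iff_deriv (n := (n : WithTop ℕ∞))).1 (by exact_mod_cast hg)
      exact h.2.2
    exact contDiff_id.mul this

namespace HadamardParams

variable {P : HadamardParams}

theorem IsRieszHadamardDeriv.comb {u v u' v' : P.L2} (c : ℝ) (h : P.IsRieszHadamardDeriv u v)
    (h' : P.IsRieszHadamardDeriv u' v') :
    P.IsRieszHadamardDeriv (c • u + u') (c • v + v') := by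
  intro g hg
  have hc : ((c • v + v' : P.L2) : ℝ → ℝ) =ᵐ[P.vol] fun t => c * v t + v' t := by
    filter_upwards [Lp.coeFn_add (c • v) v', Lp.coeFn_smul c v] with t h1 h2
    rw [h1, Pi.add_apply, h2, Pi.smul_apply, smul_eq_mul]
  have hcont := continuous_hadamardOp_iterate P.n g hg.contDiff
  rw [P.weighted_integral_comb hg.contDiff.continuous ((Lp.memLp v).integrable (by norm_num))
    ((Lp.memLp v').integrable (by norm_num)) hc, h g hg, h' g hg]
  simp only [leftPairing, rightPairing]
  rw [P.weighted_integral_comb hcont (P.integrable_leftIntegral u) (P.integrable_leftIntegral u')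
      (P.leftIntegral_comb c u u'),
    P.weighted_integral_comb hcont (P.integrable_rightIntegral u) (P.integrable_rightIntegral u')
      (P.rightIntegral_comb c u u')]
  ring

theorem isRieszHadamardDeriv_zero : P.IsRieszHadamardDeriv 0 0 := by
  intro g hg
  have h0 : ((0 : P.L2) : ℝ → ℝ) =ᵐ[P.vol] fun _ => 0 := Lp.coeFn_zero _ _ _
  have hl : ∀ x ∈ Icc P.a P.b, P.leftIntegral (0 : P.L2) x = 0 := fun x hx => by
    rw [P.leftIntegral_eq _ hx, integral_eq_zero_of_ae, mul_zero]
    filter_upwards [P.indicator_ae_eq h0] with t ht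
    rw [ht]; simp
  have hr : ∀ x ∈ Icc P.a P.b, P.rightIntegral (0 : P.L2) x = 0 := fun x hx => by
    rw [P.rightIntegral_eq _ hx, integral_eq_zero_of_ae, mul_zero]
    filter_upwards [P.indicator_ae_eq h0] with t ht
    rw [ht]; simp
  simp only [leftPairing, rightPairing, intervalIntegral.integral_of_le P.a_lt_b.le,
    ← integral_Icc_eq_integral_Ioc]
  rw [integral_eq_zero_of_ae (by filter_upwards [h0] with x hx; rw [hx]; simp),
    integral_eq_zero_of_ae (by
      filter_upwards [ae_restrict_mem measurableSet_Icc] with x hx; rw [hl x hx]; simp),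
    integral_eq_zero_of_ae (by
      filter_upwards [ae_restrict_mem measurableSet_Icc] with x hx; rw [hr x hx]; simp)]
  simp

/-- The weak Riesz–Hadamard derivative is unique. -/
theorem IsRieszHadamardDeriv.unique {u v v' : P.L2} (h : P.IsRieszHadamardDeriv u v)
    (h' : P.IsRieszHadamardDeriv u v') : v = v' := by
  have hv : Integrable (fun x => v x) P.vol := (Lp.memLp v).integrable (by norm_num)
  have hv' : Integrable (fun x => v' x) P.vol := (Lp.memLp v').integrable (by norm_num)
  have hcont : ContinuousOn (fun x : ℝ => x⁻¹) (Icc P.a P.b) :=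
    continuousOn_inv₀.mono fun x hx => (P.a_pos.trans_le hx.1).ne'
  have key : ∀ᵐ x, x ∈ Ioo P.a P.b → (v x - v' x) * x⁻¹ = 0 := by
    refine isOpen_Ioo.ae_eq_zero_of_integral_contDiff_smul_eq_zero ?_ ?_
    · refine (IntegrableOn.mono_set ?_ Ioo_subset_Icc_self).locallyIntegrableOn
      exact IntegrableOn.mul_continuousOn (μ := volume)
        (show IntegrableOn (fun x => v x - v' x) (Icc P.a P.b) volume from hv.sub hv')
        hcont isCompact_Icc
    · intro g hg _ hs
      have hs' : Function.support g ⊆ Icc P.a P.b :=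
        (subset_tsupport g).trans (hs.trans Ioo_subset_Icc_self)
      have hT : P.IsTest g := ⟨hg.of_le (by exact_mod_cast le_top), hs'⟩
      have hc : ∀ᵐ x ∂P.vol, v x - v' x = (-1) * v' x + v x :=
        Filter.Eventually.of_forall fun x => by ring
      have e := P.weighted_integral_comb hg.continuous hv' hv hc
      rw [h g hT, h' g hT] at e
      have e0 : ∫ x in P.a..P.b, x⁻¹ * ((v x - v' x) * g x) = 0 := by rw [e]; ring
      rw [intervalIntegral.integral_of_le P.a_lt_b.le, ← integral_Icc_eq_integral_Ioc] at e0
      rw [← e0, ← setIntegral_eq_integral_of_forall_compl_eq_zero (s := Icc P.a P.b)]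
      · refine integral_congr_ae (Filter.Eventually.of_forall fun x => ?_)
        simp only [smul_eq_mul]; ring
      · intro x hx
        have : g x = 0 := by
          by_contra hne
          exact hx (hs' hne)
        simp [this]
  refine Lp.ext ?_
  change ∀ᵐ x ∂(volume.restrict (Icc P.a P.b)), v x = v' x
  rw [← restrict_Ioo_eq_restrict_Icc, ae_restrict_iff' measurableSet_Ioo]
  filter_upwards [key] with x hx hxm
  have := hx hxm
  have hx0 : x⁻¹ ≠ 0 := inv_ne_zero (P.a_pos.trans hxm.1).ne'
  rcases mul_eq_zero.1 this with h1 | h1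
  · linarith
  · exact absurd h1 hx0

variable (P)

/-- The elements of `L²(Ω)` with a Riesz–Hadamard derivative of order `α` in `L²(Ω)`. -/
def sobolevSubmodule : Submodule ℝ P.L2 where
  carrier := {u | ∃ v, P.IsRieszHadamardDeriv u v}
  zero_mem' := ⟨0, isRieszHadamardDeriv_zero⟩
  add_mem' := by
    rintro u u' ⟨v, hv⟩ ⟨v', hv'⟩
    exact ⟨(1 : ℝ) • v + v', by simpa using hv.comb 1 hv'⟩
  smul_mem' := by
    rintro c u ⟨v, hv⟩
    exact ⟨c • v + 0, by simpa using hv.comb c isRieszHadamardDeriv_zero⟩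

/-- The fractional Sobolev space `W^α_2(Ω)`. -/
def Sobolev : Type := P.sobolevSubmodule

end HadamardParams

namespace HadamardParams.Sobolev

variable {P : HadamardParams}

instance : AddCommGroup P.Sobolev := inferInstanceAs (AddCommGroup P.sobolevSubmodule)

instance : Module ℝ P.Sobolev := inferInstanceAs (Module ℝ P.sobolevSubmodule)

/-- The inclusion `W^α_2(Ω) → L²(Ω)`. -/
def toL2 : P.Sobolev →ₗ[ℝ] P.L2 := P.sobolevSubmodule.subtype

theorem exists_deriv (u : P.Sobolev) : ∃ v, P.IsRieszHadamardDeriv (toL2 u) v := u.2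

/-- The Riesz–Hadamard derivative `D^α_{[a,b]} : W^α_2(Ω) → L²(Ω)`. -/
def D : P.Sobolev →ₗ[ℝ] P.L2 where
  toFun u := (exists_deriv u).choose
  map_add' u u' := by
    refine (exists_deriv (u + u')).choose_spec.unique ?_
    have := (exists_deriv u).choose_spec.comb 1 (exists_deriv u').choose_spec
    simpa using this
  map_smul' c u := by
    refine (exists_deriv (c • u)).choose_spec.unique ?_
    have := (exists_deriv u).choose_spec.comb c isRieszHadamardDeriv_zero
    simpa using this

theorem D_spec (u : P.Sobolev) : P.IsRieszHadamardDeriv (toL2 u) (D u) :=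
  (exists_deriv u).choose_spec

/-- The map `u ↦ (u, D^α u)`. -/
def toGraph : P.Sobolev →ₗ[ℝ] WithLp 2 (P.L2 × P.L2) :=
  (WithLp.linearEquiv 2 ℝ (P.L2 × P.L2)).symm.toLinearMap ∘ₗ (toL2.prod D)

theorem toGraph_injective : Function.Injective (toGraph : P.Sobolev → _) := by
  intro u v h
  have : toL2 u = toL2 v := congrArg (fun z => z.fst) h
  exact Subtype.ext this

/-- The Sobolev norm is the one transported along `u ↦ (u, D^α u)`; see `norm_sq_eq`. -/
instance : NormedAddCommGroup P.Sobolev :=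
  NormedAddCommGroup.induced _ _ (toGraph : P.Sobolev →ₗ[ℝ] _) toGraph_injective

instance : NormedSpace ℝ P.Sobolev := NormedSpace.induced ℝ _ _ (toGraph : P.Sobolev →ₗ[ℝ] _)

instance : InnerProductSpace ℝ P.Sobolev where
  inner u v := inner ℝ (toGraph u) (toGraph v)
  norm_sq_eq_re_inner u := norm_sq_eq_re_inner (𝕜 := ℝ) (toGraph u)
  conj_inner_symm u v := inner_conj_symm (𝕜 := ℝ) (toGraph u) (toGraph v)
  add_left u v w := by rw [map_add]; exact inner_add_left _ _ _
  smul_left u v c := by rw [map_smul]; exact inner_smul_left _ _ _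

instance : MeasurableSpace P.Sobolev := borel _

instance : BorelSpace P.Sobolev := ⟨rfl⟩

theorem inner_eq (u v : P.Sobolev) : inner ℝ u v =
    (∫ x in P.a..P.b, toL2 u x * toL2 v x) + ∫ x in P.a..P.b, D u x * D v x := by
  have h : inner ℝ u v = inner ℝ (toL2 u) (toL2 v) + inner ℝ (D u) (D v) :=
    WithLp.prod_inner_apply _ _
  rw [h, L2.inner_def, L2.inner_def]
  simp only [intervalIntegral.integral_of_le P.a_lt_b.le, ← integral_Icc_eq_integral_Ioc,
    RCLike.inner_apply, conj_trivial, mul_comm]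

theorem norm_sq_eq (u : P.Sobolev) : ‖u‖ ^ 2 =
    (∫ x in P.a..P.b, |toL2 u x| ^ 2) + ∫ x in P.a..P.b, |D u x| ^ 2 := by
  rw [← real_inner_self_eq_norm_sq, inner_eq]
  simp only [sq_abs]
  simp only [sq]

end HadamardParams.Sobolev

/-- The weighted norm `‖z‖_Σ = ‖Σ^{-1/2} z‖₂` on `ℝ^m`. -/
def covNorm {m : ℕ} (S : Matrix (Fin m) (Fin m) ℝ) (z : EuclideanSpace ℝ (Fin m)) : ℝ :=
  ‖WithLp.toLp 2 (Matrix.mulVec (CFC.sqrt S)⁻¹ (WithLp.ofLp z))‖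

namespace HadamardParams

variable {P : HadamardParams} {m : ℕ}

/-- Growth and local Lipschitz assumptions on the forward operator. -/
structure IsForward (S : Matrix (Fin m) (Fin m) ℝ)
    (G : P.Sobolev → EuclideanSpace ℝ (Fin m)) : Prop where
  growth : ∀ ε : ℝ, 0 < ε → ∃ M : ℝ, ∀ u, covNorm S (G u) ≤ Real.exp (ε * ‖u‖ ^ 2 + M)
  lipschitz : ∀ r : ℝ, 0 < r → ∃ K : ℝ, 0 < K ∧ ∀ u₁ u₂, max ‖u₁‖ ‖u₂‖ < r →
    covNorm S (G u₁ - G u₂) ≤ K * ‖u₁ - u₂‖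

/-- The Hadamard fractional total variation term `R(u) = lam ∫_a^b |D^α u| dx`. -/
def hftv (lam : ℝ) (u : P.Sobolev) : ℝ := lam * ∫ x in P.a..P.b, |Sobolev.D u x|

/-- The potential `Φ(u) = (1/2) ‖G(u) - y‖_Σ^2`. -/
def potential (S : Matrix (Fin m) (Fin m) ℝ) (G : P.Sobolev → EuclideanSpace ℝ (Fin m))
    (y : EuclideanSpace ℝ (Fin m)) (u : P.Sobolev) : ℝ :=
  1 / 2 * covNorm S (G u - y) ^ 2

/-- The unnormalized density `exp(-Φ(u) - R(u))`. -/
def unnormalized (S : Matrix (Fin m) (Fin m) ℝ) (G : P.Sobolev → EuclideanSpace ℝ (Fin m))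
    (lam : ℝ) (y : EuclideanSpace ℝ (Fin m)) (u : P.Sobolev) : ℝ :=
  Real.exp (-potential S G y u - hftv lam u)

/-- The normalizing constant. -/
def partitionFn (S : Matrix (Fin m) (Fin m) ℝ) (G : P.Sobolev → EuclideanSpace ℝ (Fin m))
    (lam : ℝ) (μ₀ : Measure P.Sobolev) (y : EuclideanSpace ℝ (Fin m)) : ℝ :=
  ∫ u, unnormalized S G lam y u ∂μ₀

/-- The posterior measure, with density `exp(-Φ - R)` over `μ₀`, normalized. -/
def posterior (S : Matrix (Fin m) (Fin m) ℝ) (G : P.Sobolev → EuclideanSpace ℝ (Fin m))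
    (lam : ℝ) (μ₀ : Measure P.Sobolev) (y : EuclideanSpace ℝ (Fin m)) : Measure P.Sobolev :=
  μ₀.withDensity fun u =>
    ENNReal.ofReal (unnormalized S G lam y u / partitionFn S G lam μ₀ y)

end HadamardParams

/-- The Hellinger distance of two finite measures, computed with the dominating measure
`μ + μ'` (its value is the same for every σ-finite dominating measure). -/
def hellingerDist {X : Type*} [MeasurableSpace X] (μ μ' : Measure X) : ℝ :=
  Real.sqrt (1 / 2 * ∫ u, (Real.sqrt (μ.rnDeriv (μ + μ') u).toReal -
    Real.sqrt (μ'.rnDeriv (μ + μ') u).toReal) ^ 2 ∂(μ + μ'))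

/-- Polynomially bounded functions. -/
def PolynomiallyBounded {X E : Type*} [Norm X] [Norm E] (f : X → E) : Prop :=
  ∃ (C : ℝ) (k : ℕ), ∀ u, ‖f u‖ ≤ C * (1 + ‖u‖ ^ k)

end

/-! Since `Φ` and `R` are nonnegative, the weight `w_y = exp(-Φ(·;y) - R)` takes values in `(0, 1]`.
It is continuous in `u`: `G` is locally Lipschitz, and `R` is continuous because `D` is bounded for
the graph norm. Hence `w_y` is integrable for the probability measure `μ₀`, with `Z(y) > 0`, and
mass one forces the normalizing constant to be `1 / Z(y)`.

For stability, `√w_y = exp(-‖G(u) - y‖_Σ² / 4) · exp(-R(u) / 2)`. The profile `exp(-s² / 4)` is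
1-Lipschitz on the whole line and the second factor is at most one, so `√w_y` is 1-Lipschitz in `y`
for `‖·‖_Σ`, uniformly in `u` (`abs_sqrt_unnormalized_sub_le`). Consequently `w_y` and `Z(y)` are
2-Lipschitz. A positive lower bound for `Z` on balls of data (`exists_forall_le_partitionFn`) allows
division by `√Z`, and `hellingerDist_withDensity` turns the resulting pointwise bound into a
Hellinger bound.

For expectations, Fernique's theorem gives moments of all orders, so a polynomially bounded `f` is
`μ₀`-integrable. Then `‖f‖` dominates every `w_y • f`, and dominated convergence gives continuity in
`y`. -/

/-! ### Moments of Gaussian measures on separable normed spaces -/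

/-- A Gaussian measure on a separable normed space, complete or not, has moments of all orders. -/
theorem integrable_norm_pow_of_isGaussian {E : Type*} [NormedAddCommGroup E] [NormedSpace ℝ E]
    [SecondCountableTopology E] [MeasurableSpace E] [BorelSpace E] (μ : Measure E) [IsGaussian μ]
    (k : ℕ) : Integrable (fun x => ‖x‖ ^ k) μ := by
  borelize (UniformSpace.Completion E)
  have : SecondCountableTopology (UniformSpace.Completion E) :=
    UniformSpace.secondCountable_of_separable _
  -- The image measure is Gaussian on a Banach space, where Fernique's theorem bounds its moments;
  -- the embedding is isometric, so the norm moments are those of `μ`.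
  let L : E →L[ℝ] UniformSpace.Completion E := UniformSpace.Completion.toComplL
  have hL : Measurable L := L.continuous.measurable
  have h := (IsGaussian.memLp_id (μ.map L) k (by simp)).integrable_norm_pow'
  have h2 := (integrable_map_measure h.aestronglyMeasurable hL.aemeasurable).1 h
  refine h2.congr (Filter.Eventually.of_forall fun x => ?_)
  simp [L]

/-! ### The Hellinger distance of measures with densities -/

/-- This expresses one measure by a density over the sum of the two, the reference measure in
`hellingerDist`. Where `p + q = 0` both functions vanish, so the convention `0 / 0 = 0` is harmless.
-/
theorem withDensity_ofReal_div_add {X : Type*} [MeasurableSpace X] (μ₀ : Measure X)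
    {p q : X → ℝ} (hp : Measurable p) (hq : Measurable q) (hp0 : ∀ x, 0 ≤ p x)
    (hq0 : ∀ x, 0 ≤ q x) :
    (μ₀.withDensity fun x => ENNReal.ofReal (p x + q x)).withDensity
      (fun x => ENNReal.ofReal (p x / (p x + q x))) =
        μ₀.withDensity fun x => ENNReal.ofReal (p x) := by
  rw [← withDensity_mul _ (by fun_prop) (by fun_prop)]
  congr 1
  ext x
  rw [Pi.mul_apply, ← ENNReal.ofReal_mul (add_nonneg (hp0 x) (hq0 x))]
  congr 1
  rcases (add_nonneg (hp0 x) (hq0 x)).eq_or_lt with h | h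
  · rw [← h, zero_mul]
    linarith [hp0 x, hq0 x]
  · field_simp

/-- The squared difference of roots is homogeneous of degree one in the pair of densities: the
factor `p + q` from the change of measure cancels the denominators under the roots. -/
theorem hellingerDist_withDensity {X : Type*} [MeasurableSpace X] (μ₀ : Measure X)
    [SigmaFinite μ₀] {p q : X → ℝ} (hp : Measurable p) (hq : Measurable q)
    (hp0 : ∀ x, 0 ≤ p x) (hq0 : ∀ x, 0 ≤ q x) :
    hellingerDist (μ₀.withDensity fun x => ENNReal.ofReal (p x))
      (μ₀.withDensity fun x => ENNReal.ofReal (q x)) =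
        Real.sqrt (1 / 2 * ∫ x, (Real.sqrt (p x) - Real.sqrt (q x)) ^ 2 ∂μ₀) := by
  have hsum : (μ₀.withDensity fun x => ENNReal.ofReal (p x)) +
      (μ₀.withDensity fun x => ENNReal.ofReal (q x)) =
        μ₀.withDensity fun x => ENNReal.ofReal (p x + q x) := by
    rw [← withDensity_add_left (by fun_prop)]
    congr 1
    ext x
    exact (ENNReal.ofReal_add (hp0 x) (hq0 x)).symm
  have h1 := Measure.rnDeriv_withDensity (μ₀.withDensity fun x => ENNReal.ofReal (p x + q x))
    (f := fun x => ENNReal.ofReal (p x / (p x + q x))) (by fun_prop)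
  have h2 := Measure.rnDeriv_withDensity (μ₀.withDensity fun x => ENNReal.ofReal (p x + q x))
    (f := fun x => ENNReal.ofReal (q x / (p x + q x))) (by fun_prop)
  rw [withDensity_ofReal_div_add μ₀ hp hq hp0 hq0] at h1
  have h3 := withDensity_ofReal_div_add μ₀ hq hp hq0 hp0
  simp only [add_comm (q _)] at h3
  rw [h3] at h2
  rw [hellingerDist, hsum]
  congr 2
  have h4 : ∫ x, (Real.sqrt (((μ₀.withDensity fun x => ENNReal.ofReal (p x)).rnDeriv
        (μ₀.withDensity fun x => ENNReal.ofReal (p x + q x)) x).toReal) -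
      Real.sqrt (((μ₀.withDensity fun x => ENNReal.ofReal (q x)).rnDeriv
        (μ₀.withDensity fun x => ENNReal.ofReal (p x + q x)) x).toReal)) ^ 2
        ∂(μ₀.withDensity fun x => ENNReal.ofReal (p x + q x)) =
      ∫ x, (Real.sqrt (p x / (p x + q x)) - Real.sqrt (q x / (p x + q x))) ^ 2
        ∂(μ₀.withDensity fun x => ENNReal.ofReal (p x + q x)) := by
    refine integral_congr_ae ?_
    filter_upwards [h1, h2] with x hx hx'
    rw [hx, hx', ENNReal.toReal_ofReal (div_nonneg (hp0 x) (add_nonneg (hp0 x) (hq0 x))),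
      ENNReal.toReal_ofReal (div_nonneg (hq0 x) (add_nonneg (hp0 x) (hq0 x)))]
  rw [h4, integral_withDensity_eq_integral_toReal_smul (by fun_prop) (by simp)]
  refine integral_congr_ae (Filter.Eventually.of_forall fun x => ?_)
  have hs := add_nonneg (hp0 x) (hq0 x)
  simp only [smul_eq_mul]
  rw [ENNReal.toReal_ofReal hs, Real.sqrt_div (hp0 x), Real.sqrt_div (hq0 x), ← sub_div, div_pow,
    Real.sq_sqrt hs]
  rcases hs.eq_or_lt with h | h
  · have hp' : p x = 0 := by linarith [hp0 x, hq0 x]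
    have hq' : q x = 0 := by linarith [hp0 x, hq0 x]
    simp [hp', hq']
  · field_simp

/-! ### Elementary inequalities -/

/-- Mean value inequality: the derivative is at most 1 in absolute value because `|x| / 2 ≤ 1 + x² /
4 ≤ exp(x² / 4)`. -/
theorem abs_exp_neg_sq_sub_le (s t : ℝ) :
    |Real.exp (-s ^ 2 / 4) - Real.exp (-t ^ 2 / 4)| ≤ |s - t| := by
  have hd : ∀ x : ℝ, HasDerivAt (fun x : ℝ => Real.exp (-x ^ 2 / 4))
      (Real.exp (-x ^ 2 / 4) * (-x / 2)) x := by
    intro x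
    have h := (((hasDerivAt_id x).pow 2).neg.div_const 4).exp
    refine h.congr_deriv ?_
    simp
    ring_nf
  have hb : ∀ x ∈ (univ : Set ℝ), ‖Real.exp (-x ^ 2 / 4) * (-x / 2)‖ ≤ 1 := by
    intro x _
    rw [norm_mul, Real.norm_eq_abs, Real.norm_eq_abs, Real.abs_exp]
    have h1 : |-x / 2| ≤ Real.exp (x ^ 2 / 4) := by
      refine le_trans ?_ (Real.add_one_le_exp _)
      rw [abs_le]
      constructor <;> nlinarith [sq_nonneg (x - 1), sq_nonneg (x + 1)]
    calc Real.exp (-x ^ 2 / 4) * |-x / 2| ≤ Real.exp (-x ^ 2 / 4) * Real.exp (x ^ 2 / 4) :=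
          mul_le_mul_of_nonneg_left h1 (Real.exp_pos _).le
      _ = 1 := by rw [← Real.exp_add]; ring_nf; simp
  have h := Convex.norm_image_sub_le_of_norm_hasDerivWithin_le (s := univ)
    (fun x _ => (hd x).hasDerivWithinAt) hb convex_univ (mem_univ t) (mem_univ s)
  simpa using h

/-- Factor `x - y` as a difference of squares; the sum of the two roots is at least `√c`. -/
theorem abs_sqrt_sub_sqrt_mul_le {c x y : ℝ} (hc : 0 < c) (hx : c ≤ x) (hy : c ≤ y) :
    |Real.sqrt x - Real.sqrt y| * Real.sqrt c ≤ |x - y| := by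
  have h : x - y = (Real.sqrt x - Real.sqrt y) * (Real.sqrt x + Real.sqrt y) := by
    rw [mul_comm, ← sq_sub_sq, Real.sq_sqrt (hc.le.trans hx), Real.sq_sqrt (hc.le.trans hy)]
  rw [h, abs_mul]
  refine mul_le_mul_of_nonneg_left ?_ (abs_nonneg _)
  rw [abs_of_nonneg (by positivity)]
  linarith [Real.sqrt_le_sqrt hx, Real.sqrt_nonneg y]

/-- Stability of the square root of a normalized density. -/
theorem abs_sqrt_div_sub_sqrt_div_le {c w w' Z Z' δ : ℝ} (hc : 0 < c) (hZ : c ≤ Z) (hZ' : c ≤ Z')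
    (hw : 0 ≤ w) (hw' : 0 ≤ w') (hw1 : w' ≤ 1) (hδ : |Real.sqrt w - Real.sqrt w'| ≤ δ)
    (hδZ : |Z - Z'| ≤ 2 * δ) :
    |Real.sqrt (w / Z) - Real.sqrt (w' / Z')| ≤
      (1 / Real.sqrt c + 2 / (c * Real.sqrt c)) * δ := by
  have hκ : 0 < Real.sqrt c := Real.sqrt_pos.2 hc
  have hs := Real.sqrt_le_sqrt hZ
  have hs' := Real.sqrt_le_sqrt hZ'
  have hz := hκ.trans_le hs
  have hz' := hκ.trans_le hs'
  have hδ0 : 0 ≤ δ := (abs_nonneg _).trans hδ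
  -- Change the weight first and the normalizer second. The first term contributes `1 / √c`, the
  -- second `2 / (c √c)`.
  have h1 : Real.sqrt (w / Z) - Real.sqrt (w' / Z') =
      (Real.sqrt w - Real.sqrt w') / Real.sqrt Z +
        Real.sqrt w' * ((Real.sqrt Z' - Real.sqrt Z) / (Real.sqrt Z * Real.sqrt Z')) := by
    rw [Real.sqrt_div hw, Real.sqrt_div hw']
    field_simp
    ring
  have h2 : |(Real.sqrt w - Real.sqrt w') / Real.sqrt Z| ≤ δ / Real.sqrt c := by
    rw [abs_div, abs_of_pos hz]
    exact div_le_div₀ hδ0 hδ hκ hs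
  have h3 : |Real.sqrt Z' - Real.sqrt Z| ≤ 2 * δ / Real.sqrt c := by
    rw [le_div_iff₀ hκ]
    refine (abs_sqrt_sub_sqrt_mul_le hc hZ' hZ).trans ?_
    rwa [abs_sub_comm]
  have h4 : c ≤ Real.sqrt Z * Real.sqrt Z' := by
    calc c = Real.sqrt c * Real.sqrt c := (Real.mul_self_sqrt hc.le).symm
      _ ≤ _ := mul_le_mul hs hs' hκ.le hz.le
  have h5 : |Real.sqrt w' * ((Real.sqrt Z' - Real.sqrt Z) / (Real.sqrt Z * Real.sqrt Z'))| ≤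
      2 * δ / Real.sqrt c / c := by
    rw [abs_mul, abs_div, abs_of_pos (mul_pos hz hz'), abs_of_nonneg (Real.sqrt_nonneg _)]
    calc _ ≤ 1 * (|Real.sqrt Z' - Real.sqrt Z| / (Real.sqrt Z * Real.sqrt Z')) :=
          mul_le_mul_of_nonneg_right (Real.sqrt_le_one.2 hw1) (by positivity)
      _ ≤ _ := by
          rw [one_mul]
          exact div_le_div₀ (by positivity) h3 hc h4
  rw [h1]
  refine (abs_add_le _ _).trans ((add_le_add h2 h5).trans (le_of_eq ?_))
  field_simp

/-! ### The weighted norm -/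

section covNorm

variable {m : ℕ} (S : Matrix (Fin m) (Fin m) ℝ)

theorem covNorm_nonneg (z : EuclideanSpace ℝ (Fin m)) : 0 ≤ covNorm S z := norm_nonneg _

theorem covNorm_sub_le (z w : EuclideanSpace ℝ (Fin m)) :
    covNorm S (z - w) ≤ covNorm S z + covNorm S w := by
  unfold covNorm
  rw [WithLp.ofLp_sub, Matrix.mulVec_sub, WithLp.toLp_sub]
  exact norm_sub_le _ _

theorem abs_covNorm_sub_covNorm_le (z w : EuclideanSpace ℝ (Fin m)) :
    |covNorm S z - covNorm S w| ≤ covNorm S (z - w) := by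
  unfold covNorm
  rw [WithLp.ofLp_sub, Matrix.mulVec_sub, WithLp.toLp_sub]
  exact abs_norm_sub_norm_le _ _

theorem covNorm_sub_comm (z w : EuclideanSpace ℝ (Fin m)) :
    covNorm S (z - w) = covNorm S (w - z) := by
  unfold covNorm
  rw [WithLp.ofLp_sub, Matrix.mulVec_sub, WithLp.toLp_sub, norm_sub_rev, ← WithLp.toLp_sub,
    ← Matrix.mulVec_sub, ← WithLp.ofLp_sub]

theorem continuous_covNorm : Continuous (covNorm S) := by
  unfold covNorm
  refine Continuous.norm ((PiLp.continuous_toLp 2 _).comp ?_)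
  exact Continuous.matrix_mulVec continuous_const (PiLp.continuous_ofLp 2 _)

end covNorm

/-! ### Topology of the Sobolev space -/

namespace HadamardParams.Sobolev

variable {P : HadamardParams}

/-- Through this embedding the Sobolev space inherits separability from `L² × L²`, and `D` becomes
the restriction of a coordinate projection. -/
theorem isometry_toGraph : Isometry (toGraph : P.Sobolev → _) :=
  AddMonoidHomClass.isometry_of_norm (toGraph : P.Sobolev →ₗ[ℝ] _) fun _ => rfl

instance secondCountableTopology : SecondCountableTopology P.Sobolev := by
  have : Fact ((2 : ℝ≥0∞) ≠ ⊤) := ⟨by simp⟩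
  exact isometry_toGraph.isEmbedding.secondCountableTopology

theorem continuous_D : Continuous (D : P.Sobolev → P.L2) := by
  have h : Continuous fun z : WithLp 2 (P.L2 × P.L2) => z.snd := by fun_prop
  exact h.comp isometry_toGraph.continuous

/-- Pairing with the constant 1 in `L²` reduces the continuity of `R` to that of the inner product
and of the absolute value on `L²`. -/
theorem integral_abs_D_eq_inner (u : P.Sobolev) : ∫ x in P.a..P.b, |D u x| =
    inner ℝ (indicatorConstLp 2 MeasurableSet.univ (measure_ne_top P.vol univ) (1 : ℝ)) |D u| := by
  rw [L2.inner_indicatorConstLp_one, Measure.restrict_univ,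
    intervalIntegral.integral_of_le P.a_lt_b.le, ← integral_Icc_eq_integral_Ioc]
  exact integral_congr_ae (Lp.coeFn_abs (D u)).symm

theorem continuous_integral_abs_D : Continuous fun u : P.Sobolev => ∫ x in P.a..P.b, |D u x| := by
  simp only [integral_abs_D_eq_inner]
  refine Continuous.inner continuous_const ?_
  -- In the lattice `L²`, `|v| = v ⊔ (-v)` by definition.
  exact continuous_D.sup continuous_D.neg

end HadamardParams.Sobolev

/-! ### The unnormalized density -/

namespace HadamardParams

variable {P : HadamardParams} {m : ℕ} {S : Matrix (Fin m) (Fin m) ℝ}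
  {G : P.Sobolev → EuclideanSpace ℝ (Fin m)} {lam : ℝ}

theorem continuous_hftv : Continuous (hftv lam : P.Sobolev → ℝ) :=
  continuous_const.mul Sobolev.continuous_integral_abs_D

theorem hftv_nonneg (hlam : 0 ≤ lam) (u : P.Sobolev) : 0 ≤ hftv lam u :=
  mul_nonneg hlam (intervalIntegral.integral_nonneg P.a_lt_b.le fun _ _ => abs_nonneg _)

/-- The reverse triangle inequality transfers the local Lipschitz bound from `G` to this scalar
function, through which alone `G` enters the density. -/
theorem IsForward.continuous_covNorm_sub (hG : IsForward S G) (y : EuclideanSpace ℝ (Fin m)) :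
    Continuous fun u => covNorm S (G u - y) := by
  rw [continuous_iff_continuousAt]
  intro u
  -- The ball of radius 1 about `u` lies in the ball of radius `‖u‖ + 1` about 0.
  obtain ⟨K, -, hK⟩ := hG.lipschitz (‖u‖ + 1) (by positivity)
  refine continuousAt_of_locally_lipschitz one_pos K fun v hv => ?_
  rw [dist_eq_norm] at hv
  rw [Real.dist_eq, dist_eq_norm]
  refine (abs_covNorm_sub_covNorm_le S _ _).trans ?_
  rw [sub_sub_sub_cancel_right]
  refine hK v u (max_lt ?_ (by linarith))
  have := norm_le_norm_add_norm_sub' v u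
  linarith

theorem IsForward.continuous_unnormalized (hG : IsForward S G) (y : EuclideanSpace ℝ (Fin m)) :
    Continuous (unnormalized S G lam y) := by
  unfold unnormalized potential
  exact Real.continuous_exp.comp
    ((continuous_const.mul ((hG.continuous_covNorm_sub y).pow 2)).neg.sub continuous_hftv)

theorem unnormalized_pos (y : EuclideanSpace ℝ (Fin m)) (u : P.Sobolev) :
    0 < unnormalized S G lam y u := Real.exp_pos _

theorem unnormalized_le_one (hlam : 0 ≤ lam) (y : EuclideanSpace ℝ (Fin m)) (u : P.Sobolev) :
    unnormalized S G lam y u ≤ 1 := by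
  refine Real.exp_le_one_iff.2 ?_
  have h : 0 ≤ potential S G y u := mul_nonneg (by norm_num) (sq_nonneg _)
  linarith [hftv_nonneg hlam u]

theorem continuous_unnormalized_data (u : P.Sobolev) :
    Continuous fun y => unnormalized S G lam y u := by
  unfold unnormalized potential
  have := (continuous_covNorm S).comp (continuous_const (y := G u) |>.sub continuous_id)
  exact Real.continuous_exp.comp
    ((continuous_const.mul (this.pow 2)).neg.sub continuous_const)

/-- The square root halves the exponent, leaving the 1-Lipschitz profile `exp(-s² / 4)` at `s =
‖G(u) - y‖_Σ` times the factor `exp(-R(u) / 2) ≤ 1`, which does not depend on `y`. -/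
theorem abs_sqrt_unnormalized_sub_le (hlam : 0 ≤ lam) (y y' : EuclideanSpace ℝ (Fin m))
    (u : P.Sobolev) :
    |Real.sqrt (unnormalized S G lam y u) - Real.sqrt (unnormalized S G lam y' u)| ≤
      covNorm S (y - y') := by
  have h : ∀ z, Real.sqrt (unnormalized S G lam z u) =
      Real.exp (-covNorm S (G u - z) ^ 2 / 4) * Real.exp (-hftv lam u / 2) := by
    intro z
    rw [unnormalized, potential, ← Real.exp_half, ← Real.exp_add]
    congr 1
    ring
  rw [h, h, ← sub_mul, abs_mul, Real.abs_exp]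
  have h1 : Real.exp (-hftv lam u / 2) ≤ 1 :=
    Real.exp_le_one_iff.2 (by linarith [hftv_nonneg hlam u])
  refine (mul_le_of_le_one_right (abs_nonneg _) h1).trans ?_
  refine (abs_exp_neg_sq_sub_le _ _).trans ((abs_covNorm_sub_covNorm_le S _ _).trans ?_)
  rw [sub_sub_sub_cancel_left, covNorm_sub_comm]

/-- Difference of squares of the roots; each root is at most 1, whence the factor 2. -/
theorem abs_unnormalized_sub_le (hlam : 0 ≤ lam) (y y' : EuclideanSpace ℝ (Fin m))
    (u : P.Sobolev) :
    |unnormalized S G lam y u - unnormalized S G lam y' u| ≤ 2 * covNorm S (y - y') := by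
  have h := abs_sqrt_unnormalized_sub_le (S := S) (G := G) hlam y y' u
  have hs : ∀ z, Real.sqrt (unnormalized S G lam z u) ≤ 1 := fun z =>
    Real.sqrt_le_one.2 (unnormalized_le_one hlam z u)
  rw [← Real.sq_sqrt (unnormalized_pos (S := S) (G := G) (lam := lam) y u).le,
    ← Real.sq_sqrt (unnormalized_pos (S := S) (G := G) (lam := lam) y' u).le, sq_sub_sq, abs_mul,
    abs_of_nonneg (add_nonneg (Real.sqrt_nonneg _) (Real.sqrt_nonneg _))]
  exact mul_le_mul (by linarith [hs y, hs y']) h (abs_nonneg _) zero_le_two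

/-! ### The posterior measure -/

variable (μ₀ : Measure P.Sobolev)

theorem IsForward.integrable_unnormalized (hG : IsForward S G) (hlam : 0 ≤ lam)
    [IsFiniteMeasure μ₀] (y : EuclideanSpace ℝ (Fin m)) :
    Integrable (unnormalized S G lam y) μ₀ := by
  refine Integrable.of_bound (C := 1)
    (hG.continuous_unnormalized y).measurable.aestronglyMeasurable
    (Filter.Eventually.of_forall fun u => ?_)
  rw [Real.norm_eq_abs, abs_of_pos (unnormalized_pos y u)]
  exact unnormalized_le_one hlam y u

theorem IsForward.partitionFn_pos (hG : IsForward S G) (hlam : 0 ≤ lam)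
    [IsProbabilityMeasure μ₀] (y : EuclideanSpace ℝ (Fin m)) :
    0 < partitionFn S G lam μ₀ y := by
  rw [partitionFn, integral_pos_iff_support_of_nonneg (fun u => (unnormalized_pos y u).le)
    (hG.integrable_unnormalized μ₀ hlam y)]
  have : Function.support (unnormalized S G lam y) = univ :=
    eq_univ_of_forall fun u => (unnormalized_pos y u).ne'
  rw [this, measure_univ]
  exact one_pos

theorem IsForward.isProbabilityMeasure_posterior (hG : IsForward S G) (hlam : 0 ≤ lam)
    [IsProbabilityMeasure μ₀] (y : EuclideanSpace ℝ (Fin m)) :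
    IsProbabilityMeasure (posterior S G lam μ₀ y) := by
  have hZ := hG.partitionFn_pos μ₀ hlam y
  refine ⟨?_⟩
  rw [posterior, withDensity_apply _ MeasurableSet.univ, Measure.restrict_univ,
    ← ofReal_integral_eq_lintegral_ofReal ((hG.integrable_unnormalized μ₀ hlam y).div_const _)
      (Filter.Eventually.of_forall fun u => div_nonneg (unnormalized_pos y u).le hZ.le),
    integral_div]
  change ENNReal.ofReal (partitionFn S G lam μ₀ y / partitionFn S G lam μ₀ y) = 1
  rw [div_self hZ.ne', ENNReal.ofReal_one]

/-- Total mass one reads `c * Z(y) = 1`, which determines `c`. -/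
theorem IsForward.eq_posterior (hG : IsForward S G) (hlam : 0 ≤ lam)
    [IsProbabilityMeasure μ₀] {y : EuclideanSpace ℝ (Fin m)} {ν : Measure P.Sobolev} {c : ℝ}
    [IsProbabilityMeasure ν] (hν : ν ≪ μ₀)
    (h : ν.rnDeriv μ₀ =ᵐ[μ₀] fun u => ENNReal.ofReal (c * unnormalized S G lam y u)) :
    ν = posterior S G lam μ₀ y := by
  have hZ := hG.partitionFn_pos μ₀ hlam y
  have hν' : ν = μ₀.withDensity fun u => ENNReal.ofReal (c * unnormalized S G lam y u) := by
    rw [← withDensity_congr_ae h, Measure.withDensity_rnDeriv_eq _ _ hν]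
  have hmass : ∫⁻ u, ENNReal.ofReal (c * unnormalized S G lam y u) ∂μ₀ = 1 := by
    rw [← Measure.restrict_univ (μ := μ₀), ← withDensity_apply _ MeasurableSet.univ, ← hν',
      measure_univ]
  -- `ENNReal.ofReal` truncates at 0, so a negative `c` would give the zero measure.
  have hc : 0 ≤ c := by
    by_contra! hc
    have h0 : ∀ u, ENNReal.ofReal (c * unnormalized S G lam y u) = 0 := fun u =>
      ENNReal.ofReal_of_nonpos (mul_nonpos_of_nonpos_of_nonneg hc.le (unnormalized_pos y u).le)
    simp [h0] at hmass
  rw [← ofReal_integral_eq_lintegral_ofReal ((hG.integrable_unnormalized μ₀ hlam y).const_mul c)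
      (Filter.Eventually.of_forall fun u => mul_nonneg hc (unnormalized_pos y u).le),
    integral_const_mul] at hmass
  change ENNReal.ofReal (c * partitionFn S G lam μ₀ y) = 1 at hmass
  rw [ENNReal.ofReal_eq_one] at hmass
  rw [hν', posterior]
  congr 1
  ext u
  rw [eq_div_of_mul_eq hZ.ne' hmass, one_div, inv_mul_eq_div]

/-- For `‖y‖_Σ < r` the triangle inequality gives `‖G(u) - y‖_Σ ≤ ‖G(u)‖_Σ + r`, so a single
positive function of `u` lies below all these weights; its integral is the constant. -/
theorem IsForward.exists_forall_le_partitionFn (hG : IsForward S G) (hlam : 0 ≤ lam)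
    [IsProbabilityMeasure μ₀] (r : ℝ) :
    ∃ c : ℝ, 0 < c ∧ ∀ y, covNorm S y < r → c ≤ partitionFn S G lam μ₀ y := by
  -- The form `G u - 0` makes `continuous_covNorm_sub` applicable with data 0.
  have hcont : Continuous fun u : P.Sobolev =>
      Real.exp (-(1 / 2 * (covNorm S (G u - 0) + r) ^ 2) - hftv lam u) :=
    Real.continuous_exp.comp ((continuous_const.mul
      (((hG.continuous_covNorm_sub 0).add continuous_const).pow 2)).neg.sub continuous_hftv)
  have hint : Integrable (fun u : P.Sobolev =>
      Real.exp (-(1 / 2 * (covNorm S (G u - 0) + r) ^ 2) - hftv lam u)) μ₀ := by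
    refine Integrable.of_bound (C := 1) hcont.measurable.aestronglyMeasurable
      (Filter.Eventually.of_forall fun u => ?_)
    rw [Real.norm_eq_abs, Real.abs_exp]
    refine Real.exp_le_one_iff.2 ?_
    nlinarith [hftv_nonneg hlam u, sq_nonneg (covNorm S (G u - 0) + r)]
  refine ⟨_, integral_exp_pos hint, fun y hy => ?_⟩
  refine integral_mono hint (hG.integrable_unnormalized μ₀ hlam y) fun u => ?_
  have h1 := covNorm_sub_le S (G u) y
  have h2 : covNorm S (G u - y) ^ 2 ≤ (covNorm S (G u - 0) + r) ^ 2 := by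
    rw [sub_zero]
    exact pow_le_pow_left₀ (covNorm_nonneg S _) (by linarith) 2
  refine Real.exp_le_exp.2 ?_
  unfold potential
  linarith

theorem IsForward.abs_partitionFn_sub_le (hG : IsForward S G) (hlam : 0 ≤ lam)
    [IsProbabilityMeasure μ₀] (y y' : EuclideanSpace ℝ (Fin m)) :
    |partitionFn S G lam μ₀ y - partitionFn S G lam μ₀ y'| ≤ 2 * covNorm S (y - y') := by
  rw [partitionFn, partitionFn, ← integral_sub (hG.integrable_unnormalized μ₀ hlam y)
    (hG.integrable_unnormalized μ₀ hlam y'), ← Real.norm_eq_abs]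
  have h := norm_integral_le_of_norm_le_const (μ := μ₀) (Filter.Eventually.of_forall fun u =>
    (Real.norm_eq_abs _).le.trans (abs_unnormalized_sub_le (S := S) (G := G) hlam y y' u))
  simpa using h

/-- The roots of the normalized densities differ by at most a constant independent of `u`;
integrating its square against a probability measure preserves the bound. -/
theorem IsForward.hellingerDist_posterior_le (hG : IsForward S G) (hlam : 0 ≤ lam)
    [IsProbabilityMeasure μ₀] {c : ℝ} (hc : 0 < c) {y y' : EuclideanSpace ℝ (Fin m)}
    (hy : c ≤ partitionFn S G lam μ₀ y) (hy' : c ≤ partitionFn S G lam μ₀ y') :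
    hellingerDist (posterior S G lam μ₀ y) (posterior S G lam μ₀ y') ≤
      (1 / Real.sqrt c + 2 / (c * Real.sqrt c)) * covNorm S (y - y') := by
  have hN := covNorm_nonneg S (y - y')
  have hK : 0 ≤ (1 / Real.sqrt c + 2 / (c * Real.sqrt c)) * covNorm S (y - y') := by positivity
  rw [posterior, posterior, hellingerDist_withDensity μ₀
    ((hG.continuous_unnormalized y).measurable.div_const _)
    ((hG.continuous_unnormalized y').measurable.div_const _)
    (fun u => div_nonneg (unnormalized_pos y u).le (hc.le.trans hy))
    (fun u => div_nonneg (unnormalized_pos y' u).le (hc.le.trans hy'))]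
  refine Real.sqrt_le_iff.2 ⟨hK, ?_⟩
  have hint := integral_mono_of_nonneg (μ := μ₀)
    (f := fun u => (Real.sqrt (unnormalized S G lam y u / partitionFn S G lam μ₀ y) -
      Real.sqrt (unnormalized S G lam y' u / partitionFn S G lam μ₀ y')) ^ 2)
    (Filter.Eventually.of_forall fun u => sq_nonneg _)
    (integrable_const (((1 / Real.sqrt c + 2 / (c * Real.sqrt c)) * covNorm S (y - y')) ^ 2))
    (Filter.Eventually.of_forall fun u => by
      refine sq_le_sq.2 ?_
      rw [abs_of_nonneg hK]
      exact abs_sqrt_div_sub_sqrt_div_le hc hy hy' (unnormalized_pos y u).le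
        (unnormalized_pos y' u).le (unnormalized_le_one hlam y' u)
        (abs_sqrt_unnormalized_sub_le hlam y y' u) (hG.abs_partitionFn_sub_le μ₀ hlam y y'))
  simp only [integral_const, probReal_univ, one_smul] at hint
  -- The factor `1 / 2` in the squared Hellinger distance is simply dropped.
  nlinarith [sq_nonneg ((1 / Real.sqrt c + 2 / (c * Real.sqrt c)) * covNorm S (y - y'))]

theorem integrable_of_polynomiallyBounded [IsGaussian μ₀] {E : Type*} [NormedAddCommGroup E]
    {f : P.Sobolev → E} (hf : AEStronglyMeasurable f μ₀) (hb : PolynomiallyBounded f) :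
    Integrable f μ₀ := by
  obtain ⟨C, k, h⟩ := hb
  exact (((integrable_const 1).add (integrable_norm_pow_of_isGaussian μ₀ k)).const_mul C).mono' hf
    (Filter.Eventually.of_forall h)

/-! ### Posterior expectations and their continuity in the data -/

section expectation

variable {E : Type*} [NormedAddCommGroup E] [NormedSpace ℝ E] {f : P.Sobolev → E}

theorem norm_unnormalized_smul_le (hlam : 0 ≤ lam) (y : EuclideanSpace ℝ (Fin m))
    (u : P.Sobolev) : ‖unnormalized S G lam y u • f u‖ ≤ ‖f u‖ := by
  rw [norm_smul, Real.norm_eq_abs, abs_of_pos (unnormalized_pos y u)]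
  exact mul_le_of_le_one_left (norm_nonneg _) (unnormalized_le_one hlam y u)

theorem IsForward.integrable_unnormalized_smul (hG : IsForward S G) (hlam : 0 ≤ lam)
    (hf : Integrable f μ₀) (y : EuclideanSpace ℝ (Fin m)) :
    Integrable (fun u => unnormalized S G lam y u • f u) μ₀ :=
  hf.mono ((hG.continuous_unnormalized y).measurable.aestronglyMeasurable.smul
    hf.aestronglyMeasurable)
    (Filter.Eventually.of_forall fun u => norm_unnormalized_smul_le hlam y u)

theorem toReal_posterior_density_smul {y : EuclideanSpace ℝ (Fin m)}
    (hZ : 0 < partitionFn S G lam μ₀ y) (u : P.Sobolev) :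
    (ENNReal.ofReal (unnormalized S G lam y u / partitionFn S G lam μ₀ y)).toReal • f u =
      (partitionFn S G lam μ₀ y)⁻¹ • unnormalized S G lam y u • f u := by
  rw [ENNReal.toReal_ofReal (div_nonneg (unnormalized_pos y u).le hZ.le), smul_smul,
    inv_mul_eq_div]

theorem IsForward.integrable_posterior (hG : IsForward S G) (hlam : 0 ≤ lam)
    [IsProbabilityMeasure μ₀] (hf : Integrable f μ₀) (y : EuclideanSpace ℝ (Fin m)) :
    Integrable f (posterior S G lam μ₀ y) := by
  have hm := (hG.continuous_unnormalized (lam := lam) y).measurable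
  rw [posterior, integrable_withDensity_iff_integrable_smul' (by fun_prop) (by simp)]
  simp only [toReal_posterior_density_smul μ₀ (hG.partitionFn_pos μ₀ hlam y)]
  exact (hG.integrable_unnormalized_smul μ₀ hlam hf y).smul _

theorem IsForward.integral_posterior (hG : IsForward S G) (hlam : 0 ≤ lam)
    [IsProbabilityMeasure μ₀] (f : P.Sobolev → E) (y : EuclideanSpace ℝ (Fin m)) :
    ∫ u, f u ∂(posterior S G lam μ₀ y) =
      (partitionFn S G lam μ₀ y)⁻¹ • ∫ u, unnormalized S G lam y u • f u ∂μ₀ := by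
  have hm := (hG.continuous_unnormalized (lam := lam) y).measurable
  rw [posterior, integral_withDensity_eq_integral_toReal_smul (by fun_prop) (by simp)]
  simp only [toReal_posterior_density_smul μ₀ (hG.partitionFn_pos μ₀ hlam y)]
  rw [integral_smul]

/-- Dominated convergence: the weights are at most 1 and continuous in `y` for each `u`, so `‖f‖` is
a majorant independent of `y`. -/
theorem IsForward.continuous_integral_unnormalized_smul (hG : IsForward S G) (hlam : 0 ≤ lam)
    (hf : Integrable f μ₀) :
    Continuous fun y => ∫ u, unnormalized S G lam y u • f u ∂μ₀ :=
  continuous_of_dominated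
    (fun y => (hG.integrable_unnormalized_smul μ₀ hlam hf y).aestronglyMeasurable)
    (fun y => Filter.Eventually.of_forall fun u => norm_unnormalized_smul_le hlam y u) hf.norm
    (Filter.Eventually.of_forall fun u => (continuous_unnormalized_data u).smul continuous_const)

theorem IsForward.continuous_integral_posterior (hG : IsForward S G) (hlam : 0 ≤ lam)
    [IsProbabilityMeasure μ₀] (hf : Integrable f μ₀) :
    Continuous fun y => ∫ u, f u ∂(posterior S G lam μ₀ y) := by
  simp only [hG.integral_posterior μ₀ hlam f]
  have hZ : Continuous (partitionFn S G lam μ₀) := by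
    -- The normalizing constant is the case of the constant function 1.
    have h := hG.continuous_integral_unnormalized_smul (lam := lam) μ₀ hlam
      (integrable_const (1 : ℝ))
    simp only [smul_eq_mul, mul_one] at h
    exact h
  exact (hZ.inv₀ fun y => (hG.partitionFn_pos μ₀ hlam y).ne').smul
    (hG.continuous_integral_unnormalized_smul μ₀ hlam hf)

end expectation

end HadamardParams

/-! ### Well-posedness of the posterior -/

theorem theorem3 (P : HadamardParams) {m : ℕ} (S : Matrix (Fin m) (Fin m) ℝ) (hS : S.PosDef)
    (G : P.Sobolev → EuclideanSpace ℝ (Fin m)) (hG : HadamardParams.IsForward S G)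
    (lam : ℝ) (hlam : 0 ≤ lam) (μ₀ : Measure P.Sobolev) [IsGaussian μ₀] :
    (∀ y : EuclideanSpace ℝ (Fin m),
      Measurable (HadamardParams.unnormalized S G lam y) ∧
      Integrable (HadamardParams.unnormalized S G lam y) μ₀ ∧
      0 < HadamardParams.partitionFn S G lam μ₀ y ∧
      IsProbabilityMeasure (HadamardParams.posterior S G lam μ₀ y) ∧
      HadamardParams.posterior S G lam μ₀ y ≪ μ₀ ∧
      (HadamardParams.posterior S G lam μ₀ y).rnDeriv μ₀ =ᵐ[μ₀] (fun u => ENNReal.ofReal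
        (HadamardParams.unnormalized S G lam y u / HadamardParams.partitionFn S G lam μ₀ y)) ∧
      ∀ (ν : Measure P.Sobolev) (c : ℝ), IsProbabilityMeasure ν → ν ≪ μ₀ →
        ν.rnDeriv μ₀ =ᵐ[μ₀]
          (fun u => ENNReal.ofReal (c * HadamardParams.unnormalized S G lam y u)) →
        ν = HadamardParams.posterior S G lam μ₀ y) ∧
    (∀ r : ℝ, 0 < r → ∃ C : ℝ, 0 < C ∧ ∀ y y' : EuclideanSpace ℝ (Fin m),
      max (covNorm S y) (covNorm S y') < r →
        hellingerDist (HadamardParams.posterior S G lam μ₀ y)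
          (HadamardParams.posterior S G lam μ₀ y') ≤ C * covNorm S (y - y')) ∧
    (∀ (E : Type*) [NormedAddCommGroup E] [NormedSpace ℝ E] [CompleteSpace E]
      (f : P.Sobolev → E), AEStronglyMeasurable f μ₀ → PolynomiallyBounded f →
        (∀ y, Integrable f (HadamardParams.posterior S G lam μ₀ y)) ∧
        Continuous fun y => ∫ u, f u ∂(HadamardParams.posterior S G lam μ₀ y)) := by
  refine ⟨fun y => ⟨(hG.continuous_unnormalized y).measurable,
    hG.integrable_unnormalized μ₀ hlam y, hG.partitionFn_pos μ₀ hlam y,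
    hG.isProbabilityMeasure_posterior μ₀ hlam y, withDensity_absolutelyContinuous _ _,
    Measure.rnDeriv_withDensity μ₀
      ((hG.continuous_unnormalized y).measurable.div_const _).ennreal_ofReal,
    fun ν c _ hν h => hG.eq_posterior μ₀ hlam hν h⟩, fun r _ => ?_,
    fun E _ _ _ f hf hb => ?_⟩
  · obtain ⟨c, hc, h⟩ := hG.exists_forall_le_partitionFn μ₀ hlam r
    -- `c` bounds `Z` from below on the whole ball of radius `r`, so the constant depends on the
    -- data only through `r`.
    exact ⟨1 / Real.sqrt c + 2 / (c * Real.sqrt c), by positivity, fun y y' hy =>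
      hG.hellingerDist_posterior_le μ₀ hlam hc (h y ((le_max_left _ _).trans_lt hy))
        (h y' ((le_max_right _ _).trans_lt hy))⟩
  · have hint := HadamardParams.integrable_of_polynomiallyBounded μ₀ hf hb
    exact ⟨hG.integrable_posterior μ₀ hlam hint, hG.continuous_integral_posterior μ₀ hlam hint⟩
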